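/- All graphs are finite, simple and have at least one vertex. Cographs are the graphs obtained from $K_1$ by repeatedly taking disjoint unions and joins. The edge-connectivity $\lambda(G)$ is the minimum number of edges whose removal from $G$ results in a disconnected graph or in the one-vertex graph $K_1$. For an integer $k\ge 0$, a graph $G$ is called $k$-edge-connected if $\lambda(G)\ge k$; in addition, by convention, $K_1$ (for which $\lambda(K_1)=0$) is regarded as $1$-edge-connected. Write $\delta(G)$ for the minimum degree of $G$ and $\Delta(T)$ for the maximum degree of $T$, and for a tree $T$ with bipartition $(V_1,V_2)$ let $\beta(T)=\min\{|V_1|,|V_2|\}$ (so $\beta(K_1)=0$). For a subgraph $T'$ of $G$, $G-E(T')$ is the graph obtained from $G$ by deleting the edges of $T'$ and keeping all vertices. Let $T$ be a tree of order $m$, let $k\ge 0$ be an integer, and let $G$ be a $k$-edge-connected cograph. (1) If $\delta(G)\ge\max\{k+\Delta(T)+\beta(T)-1,\;m-1\}$, then $G$ contains a subtree $T'\cong T$ such that $G-E(T')$ is $k$-edge-connected. (2) (Hasunuma's edge-deletion conjecture for $k$-edge-connected cographs.) If $\delta(G)\ge k+m-1$, then $G$ contains a subtree $T'\cong T$ such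 that $G-E(T')$ is $k$-edge-connected. -/

import Mathlib

namespace SimpleGraph

universe u v w

/-- The join of two graphs with disjoint vertex sets: all edges of `G`, all edges of `H`, and all
edges between a vertex of `G` and a vertex of `H`. -/
def graphJoin {V : Type v} {W : Type w} (G : SimpleGraph V) (H : SimpleGraph W) :
    SimpleGraph (V ⊕ W) :=
  (G ⊕g H) ⊔ completeBipartiteGraph V W

/-- Cographs: the smallest class of graphs that contains `K₁` and is closed under disjoint union,
under join, and under isomorphism. -/
inductive IsCograph : {V : Type u} → SimpleGraph V → Prop
  | single : IsCograph (completeGraph PUnit.{u + 1})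
  | union {V W : Type u} {G : SimpleGraph V} {H : SimpleGraph W} :
      IsCograph G → IsCograph H → IsCograph (G ⊕g H)
  | join {V W : Type u} {G : SimpleGraph V} {H : SimpleGraph W} :
      IsCograph G → IsCograph H → IsCograph (graphJoin G H)
  | iso {V W : Type u} {G : SimpleGraph V} {H : SimpleGraph W} :
      (G ≃g H) → IsCograph G → IsCograph H

/-- The edge-connectivity `λ(G)` of a finite nonempty graph: the minimum number of edges whose
removal results in a disconnected graph or in the trivial graph `K₁`. -/
noncomputable def edgeConnectivity {V : Type v} (G : SimpleGraph V) : ℕ :=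
  sInf {n | ∃ F : Set (Sym2 V), F ⊆ G.edgeSet ∧ F.ncard = n ∧
    (¬ (G.deleteEdges F).Connected ∨ Nat.card V = 1)}

/-- `G` is `k`-edge-connected if `k ≤ λ(G)`; by convention `K₁`, for which `λ(K₁) = 0`, is also
`1`-edge-connected. -/
def IsKEdgeConnected {V : Type v} (G : SimpleGraph V) (k : ℕ) : Prop :=
  k ≤ G.edgeConnectivity ∨ (Nat.card V = 1 ∧ k = 1)

/-- The size of the smaller side of a bipartition of `T`. A connected bipartite graph, in particular
a tree, has exactly one bipartition up to exchanging the two sides, so that the infimum is taken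
over a single number. -/
noncomputable def smallerSide {U : Type u} (T : SimpleGraph U) : ℕ :=
  sInf {b | ∃ A B : Set U, A ∪ B = Set.univ ∧ T.IsBipartiteWith A B ∧ b = min A.ncard B.ncard}

end SimpleGraph

/-! Any copy `D` of `T` in `G` can be deleted; its position is irrelevant. Let `d = δ(G)`. A copy
exists greedily since `d ≥ m - 1`, and a connected cograph on at least two vertices is a join of `A`
and `Aᶜ`. In `le_card_interedges_sdiff`, a cut `(S, Sᶜ)` keeps `k` edges for one of two reasons.
Either one vertex has enough neighbours across the cut, because `d ≥ k + Δ(T)`; or the cut has at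
least `2d - 2` edges in `G`, of which `D` uses at most `m - 1`. Both parts reduce to `d ≥ k + Δ(T)`
when `m ≥ 2`, by `β(T) ≥ 1` and `Δ(T) ≤ m - 1` respectively. -/

/-! ### Counting edges across cuts. -/

theorem SimpleGraph.card_interedges_comm {V : Type*} (G : SimpleGraph V) [DecidableRel G.Adj]
    (S S' : Finset V) : (G.interedges S S').card = (G.interedges S' S).card :=
  have : Std.Symm G.Adj := ⟨fun _ _ ↦ Adj.symm⟩
  Rel.card_interedges_comm S S'

open Finset in
/-- In a graph `G` minus a graph `D`, the edges between `S` and its complement that come from a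
single vertex `v ∈ S` already number at least `k` if `v` has enough `G`-neighbours outside `S`. -/
theorem SimpleGraph.le_card_interedges_sdiff_of_mem {V : Type*} [Fintype V] [DecidableEq V]
    (G D : SimpleGraph V) [DecidableRel G.Adj] [DecidableRel D.Adj] {k : ℕ} {S : Finset V} {v : V}
    (hv : v ∈ S) (h : D.degree v + k ≤ #(G.neighborFinset v ∩ Sᶜ)) :
    k ≤ #((G \ D).interedges S Sᶜ) := by
  have h1 : #((G.neighborFinset v ∩ Sᶜ) \ D.neighborFinset v) ≤ #((G \ D).interedges S Sᶜ) := by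
    refine card_le_card_of_injOn (fun w ↦ (v, w)) (fun w hw ↦ ?_) (fun a _ b _ hab ↦ by simpa using hab)
    simp only [coe_sdiff, coe_inter, Set.mem_sdiff, Set.mem_inter_iff, mem_coe, mem_neighborFinset,
      mem_interedges_iff, sdiff_adj] at hw ⊢
    exact ⟨hv, hw.1.2, hw.1.1, hw.2⟩
  have h2 := le_card_sdiff (D.neighborFinset v) (G.neighborFinset v ∩ Sᶜ)
  rw [card_neighborFinset_eq_degree] at h2
  omega

open Finset in
theorem SimpleGraph.card_interedges_compl_le_card_edgeFinset {V : Type*} [Fintype V] [DecidableEq V]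
    (D : SimpleGraph V) [DecidableRel D.Adj] (S : Finset V) :
    #(D.interedges S Sᶜ) ≤ #D.edgeFinset := by
  refine card_le_card_of_injOn (fun p ↦ s(p.1, p.2)) (fun p hp ↦ ?_) ?_
  · simp only [mem_coe, mem_interedges_iff] at hp
    simpa using hp.2.2
  · rintro ⟨a, b⟩ hp ⟨c, d⟩ hq h
    simp only [mem_coe, mem_interedges_iff, mem_compl] at hp hq
    rcases Sym2.eq_iff.1 h with ⟨rfl, rfl⟩ | ⟨rfl, rfl⟩
    · rfl
    · exact absurd hp.1 hq.2.1

open Finset in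
theorem SimpleGraph.card_interedges_compl_le_sdiff_add {V : Type*} [Fintype V] [DecidableEq V]
    (G D : SimpleGraph V) [DecidableRel G.Adj] [DecidableRel D.Adj] (S : Finset V) :
    #(G.interedges S Sᶜ) ≤ #((G \ D).interedges S Sᶜ) + #D.edgeFinset := by
  refine le_trans ?_ (Nat.add_le_add_left (D.card_interedges_compl_le_card_edgeFinset S) _)
  refine (card_le_card fun p hp ↦ ?_).trans (card_union_le _ _)
  simp only [mem_union, mem_interedges_iff, sdiff_adj] at hp ⊢
  tauto

-- A vertex of `S` has at most `#S - 1` neighbours inside `S`.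
open Finset in
theorem SimpleGraph.card_mul_le_card_interedges_compl {V : Type*} [Fintype V] [DecidableEq V]
    (G : SimpleGraph V) [DecidableRel G.Adj] {d : ℕ} (hd : ∀ v, d ≤ G.degree v) (S : Finset V) :
    #S * (d + 1 - #S) ≤ #(G.interedges S Sᶜ) := by
  have h1 : G.interedges S Sᶜ =
      (S.sigma fun v ↦ G.neighborFinset v ∩ Sᶜ).map (Equiv.sigmaEquivProd V V).toEmbedding := by
    ext ⟨a, b⟩
    simp only [mem_interedges_iff, mem_map_equiv, mem_sigma, mem_inter, mem_neighborFinset,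
      Equiv.sigmaEquivProd_symm_apply]
    tauto
  rw [h1, card_map, card_sigma, ← smul_eq_mul, ← sum_const]
  refine sum_le_sum fun v hv ↦ ?_
  have h2 : #(G.neighborFinset v \ (S.erase v)) ≤ #(G.neighborFinset v ∩ Sᶜ) := by
    refine card_le_card fun w hw ↦ ?_
    simp only [mem_sdiff, mem_neighborFinset, mem_erase, mem_inter, mem_compl] at hw ⊢
    exact ⟨hw.1, fun h ↦ hw.2 ⟨hw.1.ne', h⟩⟩
  have h3 := le_card_sdiff (S.erase v) (G.neighborFinset v)
  rw [card_neighborFinset_eq_degree, card_erase_of_mem hv] at h3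
  have := hd v
  have : 0 < #S := card_pos.2 ⟨v, hv⟩
  omega

open Finset in
theorem SimpleGraph.card_mul_card_add_le_card_interedges_compl {V : Type*} [Fintype V]
    [DecidableEq V] (G : SimpleGraph V) [DecidableRel G.Adj] {A : Finset V}
    (hA : ∀ a ∈ A, ∀ b ∉ A, G.Adj a b) (S : Finset V) :
    #(S ∩ A) * #(Sᶜ \ A) + #(S \ A) * #(Sᶜ ∩ A) ≤ #(G.interedges S Sᶜ) := by
  rw [← card_product, ← card_product, ← card_union_of_disjoint]
  · refine card_le_card fun p hp ↦ ?_
    simp only [mem_union, mem_product, mem_inter, mem_sdiff, mem_compl] at hp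
    simp only [mem_interedges_iff, mem_compl]
    rcases hp with ⟨h1, h2⟩ | ⟨h1, h2⟩
    · exact ⟨h1.1, h2.1, hA _ h1.2 _ h2.2⟩
    · exact ⟨h1.1, h2.1, (hA _ h2.2 _ h1.2).symm⟩
  · rw [Finset.disjoint_left]
    intro p hp hq
    simp only [mem_product, mem_inter, mem_sdiff] at hp hq
    exact hq.1.2 hp.1.2

/-- Counts the join edges across a cut: `sᵢ` and `rᵢ` are the parts of `S` and `Sᶜ` in the two sides
of the join. If one vanishes, say `s₁ = 0`, then `s₂ ≥ d` and `r₁ ≥ 2`. If all are positive, then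
`xy ≥ x + y - 1` applies to both products. -/
theorem two_mul_le_mul_add_mul_of_two_le {d s₁ s₂ r₁ r₂ : ℕ} (hs : d ≤ s₁ + s₂) (hr : d ≤ r₁ + r₂)
    (h₁ : 2 ≤ s₁ + r₁) (h₂ : 2 ≤ s₂ + r₂) : 2 * d ≤ s₁ * r₂ + s₂ * r₁ + 2 := by
  rcases Nat.eq_zero_or_pos s₁ with rfl | hs₁
  · nlinarith
  rcases Nat.eq_zero_or_pos s₂ with rfl | hs₂
  · nlinarith
  rcases Nat.eq_zero_or_pos r₁ with rfl | hr₁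
  · nlinarith
  rcases Nat.eq_zero_or_pos r₂ with rfl | hr₂
  · nlinarith
  obtain ⟨a, rfl⟩ := Nat.exists_eq_add_of_le' hs₁
  obtain ⟨b, rfl⟩ := Nat.exists_eq_add_of_le' hs₂
  obtain ⟨c, rfl⟩ := Nat.exists_eq_add_of_le' hr₁
  obtain ⟨e, rfl⟩ := Nat.exists_eq_add_of_le' hr₂
  nlinarith [Nat.zero_le (a * e), Nat.zero_le (b * c)]

open Finset in
/-- A vertex `v` adjacent to all other vertices gives `k` edges of `G \ D` across a cut both of
whose sides are large. -/
theorem SimpleGraph.le_card_interedges_sdiff_of_universal {V : Type*} [Fintype V] [DecidableEq V]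
    (G D : SimpleGraph V) [DecidableRel G.Adj] [DecidableRel D.Adj] {d k : ℕ}
    (hD : ∀ v, D.degree v + k ≤ d) {v : V} (hv : ∀ w, w ≠ v → G.Adj v w) {S : Finset V}
    (hS : d ≤ #S) (hS' : d ≤ #Sᶜ) : k ≤ #((G \ D).interedges S Sᶜ) := by
  wlog hvS : v ∈ S generalizing S
  · have := this (S := Sᶜ) hS' (by rwa [compl_compl]) (mem_compl.2 hvS)
    rwa [compl_compl, (G \ D).card_interedges_comm] at this
  refine G.le_card_interedges_sdiff_of_mem D hvS ((hD v).trans (hS'.trans (card_le_card ?_)))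
  intro w hw
  rw [mem_compl] at hw
  simp only [mem_inter, mem_neighborFinset, mem_compl]
  exact ⟨hv w (fun h ↦ hw (h ▸ hvS)), hw⟩

open Finset in
/-- Deleting a graph `D` of small degrees and few edges from a join leaves at least `k` edges across
every cut. -/
theorem SimpleGraph.le_card_interedges_sdiff {V : Type*} [Fintype V] [DecidableEq V]
    (G D : SimpleGraph V) [DecidableRel G.Adj] [DecidableRel D.Adj] {d k : ℕ}
    (hG : ∀ v, d ≤ G.degree v) (hD : ∀ v, D.degree v + k ≤ d) (hE : #D.edgeFinset + k + 2 ≤ 2 * d)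
    {A : Finset V} (hA : A.Nonempty) (hA' : Aᶜ.Nonempty) (hAdj : ∀ a ∈ A, ∀ b ∉ A, G.Adj a b)
    {S : Finset V} (hS : S.Nonempty) (hS' : Sᶜ.Nonempty) :
    k ≤ #((G \ D).interedges S Sᶜ) := by
  have small : ∀ S : Finset V, S.Nonempty → #S < d → k ≤ #((G \ D).interedges S Sᶜ) := by
    intro S hS hlt
    rcases (Nat.one_le_iff_ne_zero.2 hS.card_pos.ne').eq_or_lt with h1 | h1
    · obtain ⟨v, rfl⟩ := card_eq_one.1 h1.symm
      refine G.le_card_interedges_sdiff_of_mem D (mem_singleton_self v) ((hD v).trans ?_)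
      refine (hG v).trans ?_
      rw [← card_neighborFinset_eq_degree]
      refine card_le_card fun w hw ↦ ?_
      rw [mem_neighborFinset] at hw
      simp [hw, hw.ne']
    · have h2 := G.card_mul_le_card_interedges_compl hG S
      have h3 := G.card_interedges_compl_le_sdiff_add D S
      obtain ⟨a, ha⟩ := Nat.exists_eq_add_of_le' h1
      obtain ⟨b, hb⟩ := Nat.exists_eq_add_of_lt hlt
      -- For `2 ≤ #S ≤ d - 1` the product `#S * (d + 1 - #S)` is smallest at the endpoints, with
      -- value `2(d - 1)`; the excess is `a * b`.
      have h4 : d + 1 - #S = b + 2 := by omega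
      rw [h4, ha] at h2
      nlinarith [Nat.zero_le (a * b)]
  by_cases h1 : #S < d
  · exact small S hS h1
  by_cases h2 : #Sᶜ < d
  · have := small Sᶜ hS' h2
    rwa [compl_compl, (G \ D).card_interedges_comm] at this
  push Not at h1 h2
  have hcA : #(S ∩ A) + #(Sᶜ ∩ A) = #A := by
    rw [inter_comm, inter_comm _ A, ← card_union_of_disjoint, ← inter_union_distrib_left,
      union_compl, inter_univ]
    exact disjoint_of_subset_left inter_subset_right
      (disjoint_of_subset_right inter_subset_right disjoint_compl_right)
  have hcA' : #(S \ A) + #(Sᶜ \ A) = #Aᶜ := by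
    rw [← card_union_of_disjoint, ← union_sdiff_distrib, union_compl, ← compl_eq_univ_sdiff]
    exact disjoint_of_subset_left sdiff_subset
      (disjoint_of_subset_right sdiff_subset disjoint_compl_right)
  -- Both sides of the cut now have at least `d` vertices. The product bound needs two vertices on
  -- each side of the join; a singleton side is a universal vertex.
  by_cases h3 : #A = 1
  · obtain ⟨v, rfl⟩ := card_eq_one.1 h3
    exact G.le_card_interedges_sdiff_of_universal D hD
      (fun w hw ↦ hAdj v (mem_singleton_self v) w (by simpa using hw)) h1 h2
  by_cases h4 : #Aᶜ = 1
  · obtain ⟨v, hv⟩ := card_eq_one.1 h4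
    refine G.le_card_interedges_sdiff_of_universal D hD (v := v) (fun w hw ↦ ?_) h1 h2
    have key : ∀ x, x ∉ A ↔ x = v := fun x ↦ by rw [← mem_compl, hv, mem_singleton]
    exact (hAdj w (by_contra fun h ↦ hw ((key w).1 h)) v ((key v).2 rfl)).symm
  have h5 := hA.card_pos
  have h6 := hA'.card_pos
  have h7 := G.card_mul_card_add_le_card_interedges_compl hAdj S
  have h8 := G.card_interedges_compl_le_sdiff_add D S
  have h9 := two_mul_le_mul_add_mul_of_two_le (d := d) (s₁ := #(S ∩ A)) (s₂ := #(S \ A))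
    (r₁ := #(Sᶜ ∩ A)) (r₂ := #(Sᶜ \ A)) (by rwa [card_inter_add_card_sdiff])
    (by rwa [card_inter_add_card_sdiff]) (by omega) (by omega)
  omega

/-! ### Embedding trees. -/

open Finset in
/-- A tree embeds in every nonempty graph whose minimum degree is at least the number of edges of
the tree. -/
theorem SimpleGraph.IsTree.nonempty_copy {V : Type*} [Fintype V] [Nonempty V] (G : SimpleGraph V)
    [DecidableRel G.Adj] : ∀ (n : ℕ) {U : Type*} [Fintype U] (T : SimpleGraph U),
    T.IsTree → Fintype.card U = n + 1 → (∀ v, n ≤ G.degree v) → Nonempty (T.Copy G) := by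
  classical
  intro n
  induction n with
  | zero =>
    intro U _ T hT hU _
    have : Subsingleton U := Fintype.card_le_one_iff_subsingleton.1 hU.le
    exact ⟨⟨⟨fun _ ↦ Classical.arbitrary V, fun {a b} h ↦ absurd (Subsingleton.elim a b) h.ne⟩,
      Function.injective_of_subsingleton _⟩⟩
  | succ n ih =>
    intro U _ T hT hU hG
    have : Nontrivial U := Fintype.one_lt_card_iff_nontrivial.1 (by omega)
    obtain ⟨v, hv⟩ := hT.exists_vert_degree_one_of_nontrivial
    obtain ⟨w, hw, hw'⟩ := degree_eq_one_iff_existsUnique_adj.1 hv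
    have hT' : (T.induce {v}ᶜ).IsTree :=
      ⟨hT.connected.induce_compl_singleton_of_degree_eq_one hv, hT.isAcyclic.induce _⟩
    have hc : Fintype.card ({v}ᶜ : Set U) = n + 1 := by
      rw [Fintype.card_compl_set, hU]; simp
    obtain ⟨f⟩ := ih (T.induce {v}ᶜ) hT' hc fun v ↦ (Nat.le_succ n).trans (hG v)
    let w₀ : ({v}ᶜ : Set U) := ⟨w, hw.ne'⟩
    -- `f w₀` has at least `n + 1` neighbours, and only `n` other vertices are occupied.
    obtain ⟨x, hx, hxf⟩ : ∃ x, G.Adj (f w₀) x ∧ ∀ u, f u ≠ x := by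
      by_contra! hcon
      have hsub : G.neighborFinset (f w₀) ⊆ (univ.image f).erase (f w₀) := by
        intro x hx
        rw [mem_neighborFinset] at hx
        obtain ⟨u, rfl⟩ := hcon x hx
        simp [hx.ne']
      have h1 := card_le_card hsub
      rw [card_neighborFinset_eq_degree, card_erase_of_mem (by simp),
        card_image_of_injective _ (show Function.Injective f from f.injective), card_univ, hc] at h1
      have := hG (f w₀)
      omega
    refine ⟨⟨⟨fun u ↦ if h : u = v then x else f ⟨u, h⟩, ?_⟩, ?_⟩⟩
    · intro a b hab
      by_cases ha : a = v
      · subst ha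
        obtain rfl := hw' b hab
        simpa [hab.ne'] using hx.symm
      · by_cases hb : b = v
        · subst hb
          obtain rfl := hw' a hab.symm
          simpa [hab.ne] using hx
        · simp only [ha, hb, dite_false]
          exact f.toHom.map_adj (v := ⟨a, ha⟩) (w := ⟨b, hb⟩) hab
    · intro a b hab
      change (if h : a = v then x else f ⟨a, h⟩) = (if h : b = v then x else f ⟨b, h⟩) at hab
      by_cases ha : a = v <;> by_cases hb : b = v
      · rw [ha, hb]
      · rw [dif_pos ha, dif_neg hb] at hab
        exact absurd hab.symm (hxf _)
      · rw [dif_neg ha, dif_pos hb] at hab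
        exact absurd hab (hxf _)
      · rw [dif_neg ha, dif_neg hb] at hab
        exact congrArg Subtype.val (f.injective hab)

/-! ### Cographs, edge-connectivity and tree parameters. -/

theorem SimpleGraph.IsCograph.nonempty {V : Type*} {G : SimpleGraph V} (hG : G.IsCograph) :
    Nonempty V := by
  induction hG with
  | single => infer_instance
  | union _ _ ih _ => exact ih.map Sum.inl
  | join _ _ ih _ => exact ih.map Sum.inl
  | iso e _ ih => exact ih.map e

/-- A connected cograph on more than one vertex is a join. -/
theorem SimpleGraph.IsCograph.exists_join {V : Type*} {G : SimpleGraph V} (hG : G.IsCograph) :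
    G.Connected → Nontrivial V →
      ∃ A : Set V, A.Nonempty ∧ Aᶜ.Nonempty ∧ ∀ a ∈ A, ∀ b ∉ A, G.Adj a b := by
  induction hG with
  | single => intro _ h; exact absurd h (not_nontrivial _)
  | @union V W G H hG hH _ _ =>
    intro h _
    obtain ⟨v⟩ := hG.nonempty
    obtain ⟨w⟩ := hH.nonempty
    obtain ⟨p⟩ := h.preconnected (Sum.inl v) (Sum.inr w)
    exfalso
    obtain ⟨d, -, h1, h2⟩ := p.exists_boundary_dart (Set.range Sum.inl) ⟨v, rfl⟩ (by simp)
    obtain ⟨a, ha⟩ := h1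
    have had := d.adj
    rw [← ha] at had
    rcases h3 : d.snd with b | b
    · exact h2 ⟨b, h3.symm⟩
    · rw [h3] at had
      simp at had
  | @join V W G H hG hH _ _ =>
    intro _ _
    obtain ⟨v⟩ := hG.nonempty
    obtain ⟨w⟩ := hH.nonempty
    refine ⟨Set.range Sum.inl, ⟨_, v, rfl⟩, ⟨Sum.inr w, by simp⟩, ?_⟩
    rintro _ ⟨a, rfl⟩ (b | b) hb
    · exact absurd ⟨b, rfl⟩ hb
    · simp [graphJoin]
  | @iso V W G H e _ ih =>
    intro h _
    obtain ⟨A, ⟨a, ha⟩, ⟨b, hb⟩, hA⟩ := ih (e.connected_iff.2 h) e.toEquiv.nontrivial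
    refine ⟨e.symm ⁻¹' A, ⟨e a, by simpa⟩, ⟨e b, by simpa using hb⟩, fun x hx y hy ↦ ?_⟩
    exact e.symm.map_adj_iff.1 (hA _ hx _ hy)

open Finset in
/-- If every cut of `H` has at least `k` edges then `H` is `k`-edge-connected. -/
theorem SimpleGraph.le_edgeConnectivity {V : Type*} [Fintype V] [Nontrivial V] [DecidableEq V]
    (H : SimpleGraph V) [DecidableRel H.Adj] {k : ℕ}
    (h : ∀ S : Finset V, S.Nonempty → Sᶜ.Nonempty → k ≤ #(H.interedges S Sᶜ)) :
    k ≤ H.edgeConnectivity := by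
  classical
  -- The infimum over an empty set would be `0`, so a disconnecting set is exhibited: all edges.
  refine le_csInf ⟨_, H.edgeSet, subset_rfl, rfl, Or.inl ?_⟩ ?_
  · intro hc
    rw [deleteEdges_edgeSet, sdiff_self] at hc
    exact not_subsingleton V (preconnected_bot_iff_subsingleton.1 hc.preconnected)
  · rintro _ ⟨F, hF, rfl, hc | hc⟩
    · have hc' : ¬ (H.deleteEdges F).Preconnected := fun hp ↦ hc ⟨hp⟩
      simp only [Preconnected, not_forall] at hc'
      obtain ⟨u, v, huv⟩ := hc'
      -- Every edge of `H` leaving the component of `u` lies in `F`.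
      let S : Finset V := univ.filter fun x ↦ (H.deleteEdges F).Reachable u x
      refine (h S ⟨u, by simp [S]⟩ ⟨v, by simpa [S] using huv⟩).trans ?_
      rw [← Set.ncard_coe_finset]
      refine Set.ncard_le_ncard_of_injOn (fun p ↦ s(p.1, p.2)) ?_ ?_ (Set.toFinite F)
      · rintro ⟨a, b⟩ hp
        simp only [mem_coe, mem_interedges_iff, mem_compl, S, mem_filter, mem_univ, true_and] at hp
        by_contra hn
        exact hp.2.1 (hp.1.trans (Adj.reachable ((deleteEdges_adj).2 ⟨hp.2.2, hn⟩)))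
      · rintro ⟨a, b⟩ hp ⟨c, d⟩ hq h
        simp only [mem_coe, mem_interedges_iff, mem_compl] at hp hq
        rcases Sym2.eq_iff.1 h with ⟨rfl, rfl⟩ | ⟨rfl, rfl⟩
        · rfl
        · exact absurd hp.1 hq.2.1
    · rw [Nat.card_eq_fintype_card] at hc
      exact absurd hc (Fintype.one_lt_card (α := V)).ne'

theorem SimpleGraph.connected_of_one_le_edgeConnectivity {V : Type*} {G : SimpleGraph V}
    (h : 1 ≤ G.edgeConnectivity) : G.Connected ∧ Nat.card V ≠ 1 := by
  have h0 : ¬ (¬ (G.deleteEdges ∅).Connected ∨ Nat.card V = 1) := fun hc ↦ by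
    have : G.edgeConnectivity ≤ 0 := Nat.sInf_le ⟨∅, Set.empty_subset _, Set.ncard_empty _, hc⟩
    omega
  rw [deleteEdges_empty] at h0
  tauto

/-- Every vertex has a neighbour, which lies on the other side. -/
theorem SimpleGraph.IsTree.one_le_smallerSide {U : Type*} [Finite U] [Nontrivial U]
    {T : SimpleGraph U} (hT : T.IsTree) : 1 ≤ T.smallerSide := by
  have ne : ∀ A B : Set U, A ∪ B = Set.univ → T.IsBipartiteWith A B → A.Nonempty := by
    intro A B hAB h
    by_contra hA
    rw [Set.not_nonempty_iff_eq_empty] at hA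
    obtain ⟨u⟩ := hT.connected.nonempty
    obtain ⟨w, hw⟩ := hT.connected.preconnected.exists_adj_of_nontrivial u
    have := h.mem_of_adj hw
    simp [hA] at this
  refine le_csInf ?_ ?_
  · obtain ⟨s, t, hst⟩ := isBipartite_iff_exists_isBipartiteWith.1 hT.isBipartite
    refine ⟨_, s, t, ?_, hst, rfl⟩
    refine Set.eq_univ_of_forall fun u ↦ ?_
    obtain ⟨w, hw⟩ := hT.connected.preconnected.exists_adj_of_nontrivial u
    exact (hst.mem_of_adj hw).imp And.left And.left
  · rintro _ ⟨A, B, hAB, h, rfl⟩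
    exact le_min ((Set.ncard_pos (Set.toFinite A)).2 (ne A B hAB h))
      ((Set.ncard_pos (Set.toFinite B)).2 (ne B A (by rwa [Set.union_comm]) h.symm))

theorem SimpleGraph.degree_map_le_maxDegree {U V : Type*} [Fintype U] [Fintype V]
    (T : SimpleGraph U) [DecidableRel T.Adj] (f : U ↪ V) [DecidableRel (T.map f).Adj] (v : V) :
    (T.map f).degree v ≤ T.maxDegree := by
  classical
  by_cases hv : ∃ u, f u = v
  · obtain ⟨u, rfl⟩ := hv
    refine le_trans ?_ (T.degree_le_maxDegree u)
    rw [← card_neighborFinset_eq_degree, ← card_neighborFinset_eq_degree,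
      ← Finset.card_map f]
    refine Finset.card_le_card fun w hw ↦ ?_
    rw [mem_neighborFinset, map_adj] at hw
    obtain ⟨a, b, hab, ha, rfl⟩ := hw
    obtain rfl := f.injective ha
    simpa using hab
  · have : (T.map f).degree v = 0 := by
      rw [← card_neighborFinset_eq_degree, Finset.card_eq_zero, Finset.eq_empty_iff_forall_notMem]
      intro w hw
      rw [mem_neighborFinset, map_adj] at hw
      obtain ⟨a, b, -, ha, -⟩ := hw
      exact hv ⟨a, ha⟩
    omega

/-! ### Deleting the tree. -/

/-- A tree `T` can be removed from a `k`-edge-connected cograph `G` if the minimum degree of `G` is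
at least `k + Δ(T)` and at least the number of edges of `T`. -/
theorem SimpleGraph.IsCograph.exists_isKEdgeConnected_deleteEdges {U : Type*} [Fintype U]
    (T : SimpleGraph U) [DecidableRel T.Adj] (hT : T.IsTree) {k : ℕ} {V : Type*} [Fintype V]
    (G : SimpleGraph V) [DecidableRel G.Adj] (hG : G.IsCograph) (hk : G.IsKEdgeConnected k)
    (hU : Fintype.card U ≤ G.minDegree + 1)
    (hΔ : 2 ≤ Fintype.card U → k + T.maxDegree ≤ G.minDegree) :
    ∃ T' : G.Subgraph, Nonempty (T ≃g T'.coe) ∧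
      (G.deleteEdges T'.edgeSet).IsKEdgeConnected k := by
  classical
  have : Nonempty V := hG.nonempty
  have : Nonempty U := hT.connected.nonempty
  have hU0 : 0 < Fintype.card U := Fintype.card_pos
  obtain ⟨f⟩ := IsTree.nonempty_copy G (Fintype.card U - 1) T hT (by omega)
    fun v ↦ (by omega : _ ≤ G.minDegree).trans (G.minDegree_le_degree v)
  refine ⟨f.toSubgraph, ⟨f.isoToSubgraph⟩, ?_⟩
  have hE : f.toSubgraph.edgeSet = (T.map f.toEmbedding).edgeSet := by
    rw [edgeSet_map, Copy.toSubgraph, Subgraph.edgeSet_map, Subgraph.edgeSet_top]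
    rfl
  rw [hE]
  generalize f.toEmbedding = e
  -- For `m = 1` nothing is deleted; this also covers `G = K₁` with `k = 1`.
  rcases hU0.nat_succ_le.eq_or_lt with h1 | h1
  · have : Subsingleton U := Fintype.card_le_one_iff_subsingleton.1 h1.ge
    have hbot : T.map e = ⊥ := by
      rw [Subsingleton.elim T ⊥]
      ext
      simp
    rwa [hbot, edgeSet_bot, deleteEdges_empty]
  replace hΔ := hΔ h1
  have : Nontrivial U := Fintype.one_lt_card_iff_nontrivial.1 h1
  rcases k.eq_zero_or_pos with rfl | hk0
  · exact Or.inl (Nat.zero_le _)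
  have hV : Nontrivial V :=
    Fintype.one_lt_card_iff_nontrivial.1 ((by omega : 1 ≤ G.minDegree).trans_lt G.minDegree_lt_card)
  have hcard : Nat.card V ≠ 1 := by
    rw [Nat.card_eq_fintype_card]; exact (Fintype.one_lt_card (α := V)).ne'
  have hk' : k ≤ G.edgeConnectivity := hk.resolve_right fun h ↦ hcard h.1
  obtain ⟨A, hA, hA', hAdj⟩ :=
    hG.exists_join (connected_of_one_le_edgeConnectivity (hk0.nat_succ_le.trans hk')).1 hV
  have hmax : 1 ≤ T.maxDegree := by
    obtain ⟨u⟩ := hT.connected.nonempty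
    exact (hT.connected.preconnected.degree_pos_of_nontrivial u).trans_le (T.degree_le_maxDegree u)
  -- If `Δ(T) ≤ 1`, the handshake lemma gives `2(m - 1) ≤ m`.
  have hmax' : Fintype.card U = 2 ∨ 2 ≤ T.maxDegree := by
    by_contra! h
    have h2 := T.sum_degrees_eq_twice_card_edges
    have h3 := hT.card_edgeFinset
    have h4 : ∑ v, T.degree v ≤ ∑ _v : U, 1 :=
      Finset.sum_le_sum fun v _ ↦ (T.degree_le_maxDegree v).trans (by omega)
    rw [Finset.sum_const, smul_eq_mul, mul_one, Finset.card_univ] at h4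
    omega
  have hedges : (T.map e).edgeFinset.card + 1 = Fintype.card U := by
    rw [← hT.card_edgeFinset, card_edgeFinset_map]
  rw [deleteEdges_edgeSet]
  refine Or.inl (le_edgeConnectivity _ fun S hS hS' ↦ ?_)
  -- The edge bound is `m + k + 1 ≤ 2d`: for `Δ(T) ≥ 2` add `m - 1 ≤ d` and `k + 2 ≤ d`; for `m = 2`
  -- use `d ≥ k + 1` and `k ≥ 1`.
  refine G.le_card_interedges_sdiff (T.map e) G.minDegree_le_degree
    (fun v ↦ (Nat.add_le_add_right (T.degree_map_le_maxDegree _ v) k).trans (by omega)) (by omega)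
    (A := A.toFinset) (by simpa) ?_ (by simpa using hAdj) hS hS'
  rwa [← Set.toFinset_compl, Set.toFinset_nonempty]

theorem mainTheorem5 {U : Type*} [Fintype U] (T : SimpleGraph U) [DecidableRel T.Adj]
    (hT : T.IsTree) (m : ℕ) (hm : Fintype.card U = m) (k : ℕ)
    {V : Type*} [Fintype V] (G : SimpleGraph V) [DecidableRel G.Adj]
    (hG : G.IsCograph) (hk : G.IsKEdgeConnected k) :
    (max ((k : ℤ) + (T.maxDegree : ℤ) + (T.smallerSide : ℤ) - 1) ((m : ℤ) - 1)
        ≤ (G.minDegree : ℤ) →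
      ∃ T' : G.Subgraph, Nonempty (T ≃g T'.coe) ∧
        (G.deleteEdges T'.edgeSet).IsKEdgeConnected k) ∧
    ((k : ℤ) + (m : ℤ) - 1 ≤ (G.minDegree : ℤ) →
      ∃ T' : G.Subgraph, Nonempty (T ≃g T'.coe) ∧
        (G.deleteEdges T'.edgeSet).IsKEdgeConnected k) := by
  subst hm
  refine ⟨fun h ↦ ?_, fun h ↦ ?_⟩
  · rw [max_le_iff] at h
    refine hG.exists_isKEdgeConnected_deleteEdges T hT G hk (by omega) fun h1 ↦ ?_
    have : Nontrivial U := Fintype.one_lt_card_iff_nontrivial.1 h1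
    have := hT.one_le_smallerSide
    omega
  · refine hG.exists_isKEdgeConnected_deleteEdges T hT G hk (by omega) fun h1 ↦ ?_
    have : Nonempty U := hT.connected.nonempty
    have := T.maxDegree_lt_card_verts
    omega
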